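/- Let $M$ be a path-connected topological space with an involution $\tau\colon M\to M$ (a continuous map with $\tau\circ\tau=\mathrm{id}$), let $k\ge 2$ be an integer, and let $X(M,S^1)=(M\times S^1)/\big((x,z)\sim(\tau(x),-z)\big)$ with the quotient topology. Suppose that $X(M,S^1)$ is Hausdorff and that $X(M,S^1)^k$ is completely normal (any two subsets $A,B$ with $\overline A\cap B=A\cap\overline B=\emptyset$ have disjoint open neighbourhoods). Then $$\mathrm{TC}_k(X(M,S^1))\;\le\; k+\mathrm{TC}^{\#,*}_{k,\langle\tau\rangle}(M)\;\le\; k\,\mathrm{cat}^{\#}_{\langle\tau\rangle}(M)+1 .$$ Here, with $I=[0,1]$ and $Y^I$ carrying the compact-open topology, $e_{k,Y}\colon Y^I\to Y^k$ is the map $\alpha\mapsto\big(\alpha(0),\alpha(\tfrac1{k-1}),\dots,\alpha(\tfrac{k-2}{k-1}),\alpha(1)\big)$, and each of the following is the least size $n$ of a cover $U_1,\dots,U_n$ as described, or $\infty$ if there is none: - $\mathrm{TC}_k(Y)$: open covers of $Y^k$ such that $e_{k,Y}$ has a continuous section over each $U_i$; - $\mathrm{TC}^{\#,*}_{k,G}(Y)$,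 for a $G$-space $Y$: open covers of $Y^k$ by sets that are invariant under the componentwise action of $G^k$, such that $e_{k,Y}$ has a continuous (not necessarily equivariant) section over each $U_i$; - $\mathrm{cat}^{\#}_{G}(Y)$, for a $G$-space $Y$: open covers of $Y$ by $G$-invariant sets $U_i$ whose inclusions $U_i\hookrightarrow Y$ are null-homotopic. -/

import Mathlib

open Topology

noncomputable section

namespace SeqTC

universe u v w

/-- A subset `U` of a `G`-space is `G`-invariant. (As `G` is a group, `g • U ⊆ U` for all `g`
amounts to `g • U = U` for all `g`.) -/
def IsInvariant (G : Type u) {X : Type v} [Group G] [MulAction G X] (U : Set X) : Prop :=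
  ∀ g : G, ∀ x ∈ U, g • x ∈ U

/-- The map `p : E → B` has a continuous section over the subset `U` of `B`. -/
def HasSectionOver {E : Type u} {B : Type v} [TopologicalSpace E] [TopologicalSpace B]
    (p : E → B) (U : Set B) : Prop :=
  ∃ s : C(U, E), ∀ x : U, p (s x) = x

/-- A subset `U` of `X` is categorical: the inclusion of `U` into `X` is null-homotopic. -/
def IsCategorical {X : Type u} [TopologicalSpace X] (U : Set X) : Prop :=
  ContinuousMap.Nullhomotopic (⟨Subtype.val, continuous_subtype_val⟩ : C(U, X))

/-- `X` has an open cover `U₁, …, Uₙ` all of whose members satisfy `P`. -/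
def HasOpenCover {X : Type u} [TopologicalSpace X] (P : Set X → Prop) (n : ℕ) : Prop :=
  ∃ U : Fin n → Set X, (∀ i, IsOpen (U i)) ∧ (⋃ i, U i) = Set.univ ∧ ∀ i, P (U i)

/-- The least size of a finite open cover of `X` whose members satisfy `P`; it is `∞` if there
is no such cover. -/
def coverNumber {X : Type u} [TopologicalSpace X] (P : Set X → Prop) : ℕ∞ :=
  sInf ((fun n : ℕ => (n : ℕ∞)) '' {n : ℕ | HasOpenCover P n})

/-- The sectional category `secat(p)`. -/
def secat {E : Type u} {B : Type v} [TopologicalSpace E] [TopologicalSpace B]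
    (p : E → B) : ℕ∞ :=
  coverNumber fun U : Set B => HasSectionOver p U

/-- The sectional category `secat_G^#(p)` of `p` with respect to `G`. The sections need not be
equivariant. -/
def secatWrt (G : Type w) {E : Type u} {B : Type v} [TopologicalSpace E] [TopologicalSpace B]
    [Group G] [MulAction G B] (p : E → B) : ℕ∞ :=
  coverNumber fun U : Set B => IsInvariant G U ∧ HasSectionOver p U

/-- The LS category `cat_G^#(X)` of `X` with respect to `G`. -/
def catWrt (G : Type w) (X : Type u) [TopologicalSpace X] [Group G] [MulAction G X] : ℕ∞ :=
  coverNumber fun U : Set X => IsInvariant G U ∧ IsCategorical U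

/-- The point `i / (k - 1)` of the unit interval, for `0 ≤ i ≤ k - 1`. -/
def node (k : ℕ) (i : Fin k) : unitInterval :=
  ⟨(i : ℝ) / ((k : ℝ) - 1), by
    have h : (i : ℝ) + 1 ≤ (k : ℝ) := by exact_mod_cast i.isLt
    have h0 : (0 : ℝ) ≤ (i : ℝ) := Nat.cast_nonneg _
    exact ⟨div_nonneg h0 (by linarith), div_le_one_of_le₀ (by linarith) (by linarith)⟩⟩

/-- The generalized free path space fibration `e_{k,X} : X^I → X^k`,
`α ↦ (α(0), α(1/(k-1)), …, α((k-2)/(k-1)), α(1))`, where `X^I` has the compact-open topology. -/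
def pathEval (k : ℕ) (X : Type u) [TopologicalSpace X] : C(unitInterval, X) → (Fin k → X) :=
  fun α i => α (node k i)

/-- The `k`-th sequential topological complexity `TC_k(X)`. -/
def TC (k : ℕ) (X : Type u) [TopologicalSpace X] : ℕ∞ :=
  secat (pathEval k X)

/-- The `k`-th strong topological complexity `TC_{k,G}^{#,*}(X)` of `X` with respect to `G`:
the group `G^k` acts on `X^k` componentwise. -/
def strongTCWrt (k : ℕ) (G : Type w) (X : Type u) [TopologicalSpace X] [Group G]
    [MulAction G X] : ℕ∞ :=
  letI : MulAction (Fin k → G) (Fin k → X) := Pi.mulAction'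
  secatWrt (Fin k → G) (pathEval k X)

/-- The group of self-homeomorphisms of `X`, and with it each of its subgroups, acts on `X` by
evaluation. -/
instance homeoMulAction (X : Type u) [TopologicalSpace X] : MulAction (X ≃ₜ X) X where
  smul f x := f x
  one_smul _ := rfl
  mul_smul _ _ _ := rfl

/-- The equivalence relation `(x, y) ∼ (τ x, σ y)` on `M × N`, for involutions `τ` and `σ`. -/
def gppsSetoid {M : Type u} {N : Type v} (τ : M → M) (σ : N → N)
    (hτ : Function.Involutive τ) (hσ : Function.Involutive σ) : Setoid (M × N) where
  r p q := q = p ∨ q = (τ p.1, σ p.2)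
  iseqv :=
    { refl := fun _ => Or.inl rfl
      symm := by
        rintro ⟨a, b⟩ ⟨c, d⟩ (h | h)
        · exact Or.inl h.symm
        · obtain ⟨rfl, rfl⟩ := Prod.mk.inj h
          exact Or.inr (by simp [hτ a, hσ b])
      trans := by
        rintro ⟨a, b⟩ ⟨c, d⟩ ⟨e, f⟩ (h | h) (h' | h')
        · exact Or.inl (h'.trans h)
        · obtain ⟨rfl, rfl⟩ := Prod.mk.inj h
          exact Or.inr h'
        · exact Or.inr (h'.trans h)
        · obtain ⟨rfl, rfl⟩ := Prod.mk.inj h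
          exact Or.inl (by simpa [hτ a, hσ b] using h') }

/-- The generalized projective product space `X(M, N) = (M × N) / ((x, y) ∼ (τ x, σ y))`. -/
def GPPS {M : Type u} {N : Type v} (τ : M → M) (σ : N → N)
    (hτ : Function.Involutive τ) (hσ : Function.Involutive σ) : Type (max u v) :=
  Quotient (gppsSetoid τ σ hτ hσ)

/-- `X(M, N)` carries the quotient topology. -/
instance GPPS.instTopologicalSpace {M : Type u} {N : Type v} [TopologicalSpace M]
    [TopologicalSpace N] (τ : M → M) (σ : N → N)
    (hτ : Function.Involutive τ) (hσ : Function.Involutive σ) :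
    TopologicalSpace (GPPS τ σ hτ hσ) :=
  inferInstanceAs (TopologicalSpace (Quotient (gppsSetoid τ σ hτ hσ)))

/-- The space `X(M, S¹)`, where the circle has the antipodal involution `z ↦ -z`. -/
abbrev GPPSCircle {M : Type u} (τ : M → M) (hτ : Function.Involutive τ) : Type u :=
  GPPS τ (fun z : Circle => -z) hτ neg_involutive

end SeqTC

end

/-! An open cover with `n + 1` members has a rank, the least index of a member containing a point;
it is upper semicontinuous with values at most `n`. Given several such ranks, two different joint
level sets with the same sum of ranks are separated: ranks can only drop at a limit point, and equal
sums forbid a proper drop. In a completely normal space such level sets thicken to disjoint open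
sets, over whose union sections glue. So one open set per value of the sum suffices
(`hasOpenCover_of_rank`), and the bounds of the ranks add up.

For the second inequality, the ranks are those of the `k` coordinates in a categorical cover of `M`;
over a product of categorical sets, paths run through a common contraction point. `M^k` inherits
complete normality from `X(M, S¹)^k` via `x ↦ [x, 1]`.

For the first, invariant sets of `M^k` descend to `X(M, S¹)^k`. Their rank is joined by `k` bits
recording whether the `j`-th circle coordinate is real. Fixed bits single out a half circle for each
coordinate, hence continuous representatives and arguments (`hasSectionOver_saturation`). -/

namespace SeqTC

/-! ### Ranks of finite covers -/

section CoverRank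

variable {X : Type*} {n : ℕ} {U : Fin n → Set X}

/-- The least index of a member of the family `U` that contains `x`. -/
noncomputable def coverRank (U : Fin n → Set X) (x : X) : ℕ :=
  sInf {i | ∃ h : i < n, x ∈ U ⟨i, h⟩}

theorem exists_mem_coverRank (hU : ⋃ i, U i = Set.univ) (x : X) :
    ∃ h : coverRank U x < n, x ∈ U ⟨coverRank U x, h⟩ := by
  obtain ⟨i, hi⟩ := Set.mem_iUnion.1 (hU.symm ▸ Set.mem_univ x : x ∈ ⋃ i, U i)
  exact Nat.sInf_mem (s := {i | ∃ h : i < n, x ∈ U ⟨i, h⟩}) ⟨i, i.2, hi⟩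

theorem coverRank_lt_iff (hU : ⋃ i, U i = Set.univ) {x : X} {i : ℕ} :
    coverRank U x < i ↔ ∃ j : Fin n, (j : ℕ) < i ∧ x ∈ U j := by
  refine ⟨fun h => ?_, ?_⟩
  · obtain ⟨h', hx⟩ := exists_mem_coverRank hU x
    exact ⟨_, h, hx⟩
  · rintro ⟨j, hj, hx⟩
    exact (Nat.sInf_le (s := {i | ∃ h : i < n, x ∈ U ⟨i, h⟩}) ⟨j.2, hx⟩).trans_lt hj

theorem IsInvariant.smul_mem_iff {G : Type*} [Group G] [MulAction G X] {V : Set X}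
    (hV : IsInvariant G V) (g : G) (x : X) : g • x ∈ V ↔ x ∈ V :=
  ⟨fun h => by simpa using hV g⁻¹ _ h, hV g x⟩

theorem coverRank_smul {G : Type*} [Group G] [MulAction G X] (hI : ∀ i, IsInvariant G (U i))
    (g : G) (x : X) : coverRank U (g • x) = coverRank U x := by
  simp only [coverRank, (hI _).smul_mem_iff]
end CoverRank

section Covers

variable {X : Type*} [TopologicalSpace X] {P : Set X → Prop} {n : ℕ} {U : Fin n → Set X}

theorem coverNumber_le {n : ℕ} (h : HasOpenCover P n) : coverNumber P ≤ n :=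
  sInf_le ⟨n, h, rfl⟩

theorem exists_coverNumber_eq (h : coverNumber P ≠ ⊤) :
    ∃ n : ℕ, coverNumber P = n ∧ HasOpenCover P n := by
  have hne : ((fun n : ℕ => (n : ℕ∞)) '' {n : ℕ | HasOpenCover P n}).Nonempty := by
    by_contra hc
    rw [Set.not_nonempty_iff_eq_empty] at hc
    exact h (by rw [coverNumber, hc, sInf_empty])
  obtain ⟨n, hn, hn'⟩ := csInf_mem hne
  exact ⟨n, hn'.symm, hn⟩

theorem coverNumber_mono {Q : Set X → Prop} (h : ∀ U, P U → Q U) :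
    coverNumber Q ≤ coverNumber P :=
  sInf_le_sInf <| Set.image_mono fun _ ⟨U, hU, hc, hP⟩ => ⟨U, hU, hc, fun i => h _ (hP i)⟩

theorem isOpen_coverRank_lt (hU : ⋃ i, U i = Set.univ) (hO : ∀ i, IsOpen (U i)) (i : ℕ) :
    IsOpen {x | coverRank U x < i} := by
  have : {x | coverRank U x < i} = ⋃ j : Fin n, ⋃ _ : (j : ℕ) < i, U j := by
    ext x
    simp [coverRank_lt_iff hU]
  rw [this]
  exact isOpen_iUnion fun j => isOpen_iUnion fun _ => hO j

end Covers

/-! ### Restricting and gluing sections -/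

section Sections

variable {E B : Type*} [TopologicalSpace E] [TopologicalSpace B] {p : E → B}

theorem HasSectionOver.empty : HasSectionOver p ∅ :=
  ⟨⟨fun x => x.2.elim, continuous_of_discreteTopology⟩, fun x => x.2.elim⟩

theorem HasSectionOver.mono {U V : Set B} (h : HasSectionOver p V) (hUV : U ⊆ V) :
    HasSectionOver p U := by
  obtain ⟨s, hs⟩ := h
  exact ⟨s.comp ⟨Set.inclusion hUV, continuous_inclusion hUV⟩, fun x => hs (Set.inclusion hUV x)⟩

theorem HasSectionOver.iUnion {ι : Type*} {U : ι → Set B} (hO : ∀ i, IsOpen (U i))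
    (hd : Pairwise fun i j => Disjoint (U i) (U j)) (h : ∀ i, HasSectionOver p (U i)) :
    HasSectionOver p (⋃ i, U i) := by
  choose s hs using h
  let V : ι → Set ↥(⋃ i, U i) := fun i => Subtype.val ⁻¹' U i
  let f : ∀ i, C(V i, E) := fun i => (s i).comp ⟨fun x => ⟨x.1.1, x.2⟩, by fun_prop⟩
  have hf : ∀ i j x (hi : x ∈ V i) (hj : x ∈ V j), f i ⟨x, hi⟩ = f j ⟨x, hj⟩ := by
    intro i j x hi hj
    obtain rfl : i = j := by
      by_contra hij
      exact Set.disjoint_left.1 (hd hij) hi hj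
    rfl
  have hV : ∀ x, ∃ i, V i ∈ 𝓝 x := by
    intro x
    obtain ⟨i, hi⟩ := Set.mem_iUnion.1 x.2
    exact ⟨i, ((hO i).preimage continuous_subtype_val).mem_nhds hi⟩
  refine ⟨ContinuousMap.liftCover V f hf hV, fun x => ?_⟩
  obtain ⟨i, hi⟩ := Set.mem_iUnion.1 x.2
  have := ContinuousMap.liftCover_coe (hφ := hf) (hS := hV) (⟨x, hi⟩ : V i)
  simp only at this
  rw [this]
  exact hs i ⟨x.1, hi⟩

end Sections

/-! ### Separating joint level sets of ranks -/

/-- In a completely normal space, sections near the joint level sets of upper semicontinuous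
invariant ranks `ρ c`, with values at most `d c`, give an invariant open cover with
`∑ c, d c + 1` members over which there are sections. -/
theorem hasOpenCover_of_rank {E Y G κ : Type*} [TopologicalSpace E] [TopologicalSpace Y]
    [CompletelyNormalSpace Y] [Group G] [Finite G] [MulAction G Y] [Fintype κ]
    (hG : ∀ g : G, Continuous fun y : Y => g • y) {p : E → Y} {ρ : κ → Y → ℕ} {d : κ → ℕ}
    (hd : ∀ c y, ρ c y ≤ d c) (hO : ∀ c i, IsOpen {y | ρ c y < i})
    (hI : ∀ c (g : G) y, ρ c (g • y) = ρ c y)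
    (hs : ∀ y, ∃ O, IsOpen O ∧ {y' | ∀ c, ρ c y' = ρ c y} ⊆ O ∧ HasSectionOver p O) :
    HasOpenCover (fun U => IsInvariant G U ∧ HasSectionOver p U) (∑ c, d c + 1) := by
  classical
  let ι := ∀ c, Fin (d c + 1)
  let L : ι → Set Y := fun a => {y | ∀ c, ρ c y = a c}
  have hs' : ∀ a : ι, ∃ O, IsOpen O ∧ L a ⊆ O ∧ HasSectionOver p O := by
    intro a
    rcases (L a).eq_empty_or_nonempty with h | ⟨y, hy⟩
    · exact ⟨∅, isOpen_empty, h.subset, .empty⟩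
    · obtain ⟨O, h1, h2, h3⟩ := hs y
      exact ⟨O, h1, fun y' hy' => h2 fun c => (hy' c).trans (hy c).symm, h3⟩
  choose O hOo hLO hOs using hs'
  -- Each condition `a c ≤ ρ c y` is closed, so a limit point of `L a` lying in `L b` forces `a ≤
  -- b`; equal sums then give `a = b`.
  have hcl : ∀ a b : ι, a ≠ b → ∑ c, (a c : ℕ) = ∑ c, (b c : ℕ) →
      Disjoint (closure (L a)) (L b) := by
    intro a b hab hsum
    rw [Set.disjoint_left]
    intro y hy hyb
    have hle : ∀ c, (a c : ℕ) ≤ b c := by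
      intro c
      have hc : IsClosed {y | (a c : ℕ) ≤ ρ c y} := by
        simpa [← isOpen_compl_iff, Set.compl_ofPred] using hO c (a c)
      have := closure_minimal (fun y (hy : y ∈ L a) => (hy c).ge) hc hy
      exact (hyb c) ▸ this
    refine hab (funext fun c => Fin.ext ?_)
    exact (Finset.sum_eq_sum_iff_of_le fun c _ => hle c).1 hsum c (Finset.mem_univ c)
  have hsep : ∀ a b : ι, ∃ Q R : Set Y, IsOpen Q ∧ IsOpen R ∧ L a ⊆ Q ∧ L b ⊆ R ∧
      (a ≠ b → ∑ c, (a c : ℕ) = ∑ c, (b c : ℕ) → Disjoint Q R) := by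
    intro a b
    by_cases h : a ≠ b ∧ ∑ c, (a c : ℕ) = ∑ c, (b c : ℕ)
    · obtain ⟨Q, R, h1, h2, h3, h4, h5⟩ := separatedNhds_iff_disjoint.2 <|
        CompletelyNormalSpace.completely_normal (hcl a b h.1 h.2) (hcl b a h.1.symm h.2.symm).symm
      exact ⟨Q, R, h1, h2, h3, h4, fun _ _ => h5⟩
    · exact ⟨Set.univ, Set.univ, isOpen_univ, isOpen_univ, Set.subset_univ _, Set.subset_univ _,
        fun h1 h2 => (h ⟨h1, h2⟩).elim⟩
  choose Q R hQ hR hLQ hLR hQR using hsep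
  let W : ι → Set Y := fun a => O a ∩ ⋂ b, (Q a b ∩ R b a)
  have hW : ∀ a, IsOpen (W a) := fun a =>
    (hOo a).inter (isOpen_iInter_of_finite fun b => (hQ a b).inter (hR b a))
  -- Intersecting all translates makes the set invariant; it stays open because `G` is finite, and
  -- still contains the invariant set `L a`.
  let V : ι → Set Y := fun a => ⋂ g : G, (fun y => g • y) ⁻¹' W a
  have hV : ∀ a, IsOpen (V a) := fun a =>
    isOpen_iInter_of_finite fun g => (hW a).preimage (hG g)
  have hLV : ∀ a, L a ⊆ V a := by
    intro a y hy
    refine Set.mem_iInter.2 fun g => ?_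
    have hgy : g • y ∈ L a := fun c => (hI c g y).trans (hy c)
    exact ⟨hLO a hgy, Set.mem_iInter.2 fun b => ⟨hLQ a b hgy, hLR b a hgy⟩⟩
  have hVW : ∀ a, V a ⊆ W a := fun a y hy => by simpa using Set.mem_iInter.1 hy 1
  have hVI : ∀ a, IsInvariant G (V a) := by
    intro a g y hy
    refine Set.mem_iInter.2 fun g' => ?_
    have := Set.mem_iInter.1 hy (g' * g)
    simpa [mul_smul] using this
  have hVd : ∀ a b, a ≠ b → ∑ c, (a c : ℕ) = ∑ c, (b c : ℕ) → Disjoint (V a) (V b) := by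
    intro a b hab hsum
    exact (hQR a b hab hsum).mono
      (fun y hy => (Set.mem_iInter.1 (hVW a hy).2 b).1)
      (fun y hy => (Set.mem_iInter.1 (hVW b hy).2 a).2)
  refine ⟨fun l => ⋃ a : {a : ι // ∑ c, (a c : ℕ) = l}, V a.1,
    fun l => isOpen_iUnion fun a => hV a, ?_, fun l => ⟨?_, ?_⟩⟩
  · refine Set.eq_univ_of_forall fun y => ?_
    let a : ι := fun c => ⟨ρ c y, Nat.lt_succ_of_le (hd c y)⟩
    have ha : ∑ c, (a c : ℕ) < ∑ c, d c + 1 :=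
      Nat.lt_succ_of_le (Finset.sum_le_sum fun c _ => hd c y)
    exact Set.mem_iUnion.2 ⟨⟨_, ha⟩, Set.mem_iUnion.2 ⟨⟨a, rfl⟩, hLV a fun c => rfl⟩⟩
  · intro g y hy
    obtain ⟨a, ha⟩ := Set.mem_iUnion.1 hy
    exact Set.mem_iUnion.2 ⟨a, hVI a g y ha⟩
  · refine HasSectionOver.iUnion (fun a => hV a) (fun a b hab => ?_) fun a =>
      (hOs a).mono fun y hy => (hVW a hy).1
    exact hVd a b (fun h => hab (Subtype.ext h)) (a.2.trans b.2.symm)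

/-! ### Tent functions and planning by contractions -/

/-- The tent function on the unit interval that vanishes at the `j`-th node only and is `1` away
from it. -/
noncomputable def tent (k : ℕ) (j : Fin k) (t : unitInterval) : unitInterval :=
  Set.projIcc 0 1 zero_le_one |2 * (((k : ℝ) - 1) * t - j)|

theorem continuous_tent (k : ℕ) (j : Fin k) : Continuous (tent k j) :=
  continuous_projIcc.comp (by fun_prop)

theorem tent_eq_one_iff {k : ℕ} {j : Fin k} {t : unitInterval} :
    tent k j t = 1 ↔ 1 ≤ |2 * (((k : ℝ) - 1) * t - j)| :=
  Set.projIcc_eq_right zero_lt_one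

theorem mul_node {k : ℕ} (hk : 2 ≤ k) (j : Fin k) : ((k : ℝ) - 1) * node k j = j := by
  have : (2 : ℝ) ≤ k := by exact_mod_cast hk
  exact mul_div_cancel₀ _ (by linarith)

theorem tent_node_self {k : ℕ} (hk : 2 ≤ k) (j : Fin k) : tent k j (node k j) = 0 := by
  rw [tent, mul_node hk]
  simp

theorem one_le_abs_sub {k : ℕ} {i j : Fin k} (hij : i ≠ j) : (1 : ℝ) ≤ |(i : ℝ) - j| := by
  have : (1 : ℤ) ≤ |((i : ℕ) : ℤ) - ((j : ℕ) : ℤ)| := by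
    have : (i : ℕ) ≠ j := fun h => hij (Fin.ext h)
    exact Int.one_le_abs (by omega)
  exact_mod_cast this

/-- After rescaling by `k - 1`, a tent differs from `1` only within distance `1/2` of its node, and
distinct nodes are at least `1` apart. -/
theorem tent_eq_one_or {k : ℕ} {i j : Fin k} (hij : i ≠ j) (t : unitInterval) :
    tent k i t = 1 ∨ tent k j t = 1 := by
  simp only [tent_eq_one_iff]
  by_contra! h
  have h1 := one_le_abs_sub hij
  rw [abs_lt, abs_lt] at h
  rcases le_abs.1 h1 with h' | h' <;> linarith [h.1.1, h.1.2, h.2.1, h.2.2]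

theorem tent_node_of_ne {k : ℕ} (hk : 2 ≤ k) {i j : Fin k} (hij : i ≠ j) :
    tent k j (node k i) = 1 := by
  refine (tent_eq_one_or hij (node k i)).resolve_left fun h => ?_
  rw [tent_node_self hk] at h
  exact zero_ne_one h

theorem HasSectionOver.pathEval_of_continuousOn {k : ℕ} {X : Type*} [TopologicalSpace X]
    {U : Set (Fin k → X)} (F : U → unitInterval → X) (hF : Continuous (Function.uncurry F))
    (h : ∀ m j, F m (node k j) = m.1 j) : HasSectionOver (pathEval k X) U :=
  ⟨⟨fun m => ⟨F m, hF.comp (Continuous.prodMk_right m)⟩,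
    ContinuousMap.continuous_of_continuous_uncurry _ hF⟩, fun m => funext (h m)⟩

theorem IsCategorical.exists_contraction {X : Type*} [TopologicalSpace X] [PathConnectedSpace X]
    {U : Set X} (hU : IsCategorical U) (c : X) :
    ∃ H : C(unitInterval × U, X), (∀ x, H (0, x) = x) ∧ ∀ x, H (1, x) = c := by
  obtain ⟨y, hy⟩ := hU
  have hyc : ContinuousMap.Homotopic (ContinuousMap.const U y) (ContinuousMap.const U c) := by
    obtain ⟨γ⟩ := PathConnectedSpace.joined y c
    exact ⟨⟨⟨fun p => γ p.1, by fun_prop⟩, by simp, by simp⟩⟩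
  obtain ⟨H⟩ := hy.trans hyc
  exact ⟨H.toContinuousMap, fun x => H.apply_zero x, fun x => H.apply_one x⟩

/-- Path-connectedness lets all contractions end at one point `c`. Between consecutive nodes the
path follows one contraction to `c` and the next one back, timed by the tents. -/
theorem hasSectionOver_pathEval_of_isCategorical {k : ℕ} (hk : 2 ≤ k) {X : Type*}
    [TopologicalSpace X] [PathConnectedSpace X] {U : Fin k → Set X}
    (hU : ∀ j, IsCategorical (U j)) : HasSectionOver (pathEval k X) {m | ∀ j, m j ∈ U j} := by
  classical
  obtain ⟨c⟩ : Nonempty X := inferInstance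
  choose H H0 H1 using fun j => (hU j).exists_contraction c
  -- At most one tent differs from `1`, so the chosen index is unique; the default `c` is the value
  -- of every contraction at time `1`.
  let F : {m : Fin k → X | ∀ j, m j ∈ U j} → unitInterval → X := fun m t =>
    if h : ∃ j, tent k j t ≠ 1 then H h.choose (tent k h.choose t, ⟨m.1 h.choose, m.2 _⟩) else c
  have hF : ∀ m t j, (∀ i, i ≠ j → tent k i t = 1) →
      F m t = H j (tent k j t, ⟨m.1 j, m.2 j⟩) := by
    intro m t j hj
    by_cases h : ∃ j, tent k j t ≠ 1
    · have hc : h.choose = j := by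
        by_contra hc
        exact h.choose_spec (hj _ hc)
      simp only [F, dif_pos h]
      rw! [hc]
      rfl
    · simp only [F, dif_neg h]
      push Not at h
      rw [h j, H1]
  refine HasSectionOver.pathEval_of_continuousOn F ?_ fun m j => ?_
  · let C : Fin k → Set ({m : Fin k → X | ∀ j, m j ∈ U j} × unitInterval) := fun j =>
      {q | ∀ i, i ≠ j → tent k i q.2 = 1}
    refine (locallyFinite_of_finite C).continuous ?_ (fun j => ?_) fun j => ?_
    · refine Set.eq_univ_of_forall fun q => Set.mem_iUnion.2 ?_
      by_cases h : ∃ j, tent k j q.2 ≠ 1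
      · obtain ⟨j, hj⟩ := h
        exact ⟨j, fun i hi => (tent_eq_one_or hi q.2).resolve_right hj⟩
      · push Not at h
        exact ⟨⟨0, by omega⟩, fun i _ => h i⟩
    · simp only [C, Set.ofPred_forall]
      exact isClosed_iInter fun i => isClosed_iInter fun _ =>
        isClosed_eq ((continuous_tent k i).comp continuous_snd) continuous_const
    · have : Continuous fun q : {m : Fin k → X | ∀ j, m j ∈ U j} × unitInterval =>
          H j (tent k j q.2, ⟨q.1.1 j, q.1.2 j⟩) := by
        refine (H j).continuous.comp (Continuous.prodMk ((continuous_tent k j).comp continuous_snd)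
          (Continuous.subtype_mk ?_ _))
        exact (continuous_apply j).comp (continuous_subtype_val.comp continuous_fst)
      exact this.continuousOn.congr fun q hq => hF q.1 q.2 j hq
  · rw [hF m _ j fun i hi => tent_node_of_ne hk hi.symm, tent_node_self hk, H0]

/-- The strong topological complexity is at most `k (cat - 1) + 1`. -/
theorem strongTCWrt_le {k : ℕ} (hk : 2 ≤ k) {G X : Type*} [Group G] [Finite G]
    [TopologicalSpace X] [PathConnectedSpace X] [MulAction G X]
    (hG : ∀ g : G, Continuous fun x : X => g • x) [CompletelyNormalSpace (Fin k → X)] {n : ℕ}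
    (h : HasOpenCover (fun U : Set X => IsInvariant G U ∧ IsCategorical U) (n + 1)) :
    strongTCWrt k G X ≤ (k * n + 1 : ℕ) := by
  obtain ⟨U, hO, hc, hU⟩ := h
  let _ : MulAction (Fin k → G) (Fin k → X) := Pi.mulAction'
  refine coverNumber_le ?_
  have := hasOpenCover_of_rank (G := Fin k → G) (p := pathEval k X) (κ := Fin k)
    (ρ := fun j m => coverRank U (m j)) (d := fun _ => n)
    (fun g => continuous_pi fun j => (hG (g j)).comp (continuous_apply j))
    (fun j m => Nat.le_of_lt_succ (exists_mem_coverRank hc (m j)).1)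
    (fun j i => (isOpen_coverRank_lt hc hO i).preimage (f := fun m : Fin k → X => m j)
      (continuous_apply j))
    (fun j g m => coverRank_smul (fun i => (hU i).1) (g j) (m j))
    (fun m => ?_)
  · simpa using this
  -- On a joint level set, every coordinate lies in the member of the cover named by its rank.
  · choose hlt hmem using fun x => exists_mem_coverRank hc x
    refine ⟨{m' | ∀ j, m' j ∈ U ⟨coverRank U (m j), hlt (m j)⟩}, ?_, fun m' hm' j => ?_,
      hasSectionOver_pathEval_of_isCategorical hk fun j => (hU _).2⟩
    · simp only [Set.ofPred_forall]
      exact isOpen_iInter_of_finite fun j => (hO _).preimage (continuous_apply j)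
    · have := hmem (m' j)
      simpa only [hm' j] using this

/-! ### Continuous choice of representatives in `X(M, S¹)` -/

section Representatives

variable {M : Type*} [TopologicalSpace M] (τ : M ≃ₜ M) (hτ : Function.Involutive τ)

/-- The quotient map `M × S¹ → X(M, S¹)`. -/
noncomputable def GPPSCircle.mk (p : M × Circle) : GPPSCircle τ hτ :=
  Quotient.mk (gppsSetoid τ (fun z : Circle => -z) hτ neg_involutive) p

variable {τ hτ}

theorem GPPSCircle.mk_eq_iff {p q : M × Circle} :
    mk τ hτ p = mk τ hτ q ↔ q = p ∨ q = (τ p.1, -p.2) :=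
  Quotient.eq

theorem GPPSCircle.mk_swap (p : M × Circle) : mk τ hτ (τ p.1, -p.2) = mk τ hτ p :=
  (mk_eq_iff.2 (Or.inr rfl)).symm

theorem GPPSCircle.continuous_mk : Continuous (mk τ hτ) :=
  continuous_quotient_mk'

theorem GPPSCircle.mk_surjective : Function.Surjective (mk τ hτ) :=
  Quotient.mk_surjective

theorem GPPSCircle.isOpenQuotientMap_mk : IsOpenQuotientMap (mk τ hτ) := by
  refine ⟨mk_surjective, continuous_mk, fun U hU => ?_⟩
  have hq : IsQuotientMap (mk τ hτ) := isQuotientMap_quotient_mk'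
  rw [← hq.isOpen_preimage]
  have : mk τ hτ ⁻¹' (mk τ hτ '' U) = U ∪ (fun p : M × Circle => (τ p.1, -p.2)) ⁻¹' U := by
    ext p
    simp only [Set.mem_preimage, Set.mem_image, Set.mem_union]
    constructor
    · rintro ⟨q, hq, h⟩
      rcases mk_eq_iff.1 h.symm with rfl | rfl
      · exact Or.inl hq
      · exact Or.inr hq
    · rintro (h | h)
      · exact ⟨p, h, rfl⟩
      · exact ⟨_, h, mk_swap p⟩
  rw [this]
  exact hU.union (hU.preimage (by fun_prop))

theorem GPPSCircle.exists_smul_eq {p q : M × Circle} (h : mk τ hτ p = mk τ hτ q) :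
    ∃ g : Subgroup.zpowers τ, g • p.1 = q.1 := by
  rcases mk_eq_iff.1 h with rfl | rfl
  · exact ⟨1, one_smul _ _⟩
  · exact ⟨⟨τ, Subgroup.mem_zpowers τ⟩, rfl⟩

open Classical in
/-- The representative in the half of the circle on which the odd function `h` is positive. -/
noncomputable def GPPSCircle.halfRep (h : Circle → ℝ) (x : GPPSCircle τ hτ) : M × Circle :=
  if 0 < h (Quotient.out x).2 then Quotient.out x
  else (τ (Quotient.out x).1, -(Quotient.out x).2)

theorem GPPSCircle.mk_out (x : GPPSCircle τ hτ) : mk τ hτ (Quotient.out x) = x :=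
  Quotient.out_eq x

theorem GPPSCircle.mk_halfRep (h : Circle → ℝ) (x : GPPSCircle τ hτ) :
    mk τ hτ (halfRep h x) = x := by
  unfold halfRep
  split_ifs
  · exact mk_out x
  · rw [mk_swap, mk_out]

variable {h : Circle → ℝ}

theorem GPPSCircle.halfRep_mk (hodd : ∀ z, h (-z) = -h z)
    {p : M × Circle} (hp : 0 < h p.2) :
    halfRep h (mk τ hτ p) = p := by
  unfold halfRep
  rcases mk_eq_iff.1 (mk_out (mk τ hτ p)).symm with h' | h'
  · rw [h', if_pos hp]
  · rw [h', if_neg]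
    · simp [hτ p.1]
    · simp only [hodd]
      linarith

theorem GPPSCircle.pos_of_ne (hodd : ∀ z, h (-z) = -h z)
    {x : GPPSCircle τ hτ} (hx : h (Quotient.out x).2 ≠ 0) :
    0 < h (halfRep h x).2 := by
  unfold halfRep
  split_ifs with h'
  · exact h'
  · simp only [hodd]
    have := lt_of_le_of_ne (not_lt.1 h') hx
    linarith

/-- Continuity can be tested after composing with the open quotient map, and near a representative
with `h` positive the composite is the identity. -/
theorem GPPSCircle.continuousAt_halfRep (hodd : ∀ z, h (-z) = -h z)
    (hc : Continuous h) {x : GPPSCircle τ hτ}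
    (hx : h (Quotient.out x).2 ≠ 0) : ContinuousAt (halfRep h) x := by
  have hp := pos_of_ne hodd hx
  rw [← mk_halfRep h x, ← isOpenQuotientMap_mk.continuousAt_comp_iff]
  refine continuousAt_id.congr ?_
  have hO : IsOpen {p : M × Circle | 0 < h p.2} :=
    isOpen_lt continuous_const (hc.comp continuous_snd)
  filter_upwards [hO.mem_nhds hp] with p hp
  exact (halfRep_mk hodd hp).symm

theorem GPPSCircle.isOpen_ne (hodd : ∀ z, h (-z) = -h z)
    (hc : Continuous h) :
    IsOpen {x : GPPSCircle τ hτ | h (Quotient.out x).2 ≠ 0} := by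
  rw [← isOpenQuotientMap_mk.isQuotientMap.isOpen_preimage]
  have : mk τ hτ ⁻¹' {x | h (Quotient.out x).2 ≠ 0} = {p : M × Circle | h p.2 ≠ 0} := by
    ext p
    simp only [Set.mem_preimage, Set.mem_ofPred_eq]
    rcases mk_eq_iff.1 (mk_out (mk τ hτ p)).symm with h' | h'
    · rw [h']
    · rw [h', hodd, neg_ne_zero]
  rw [this]
  exact isOpen_ne_fun (hc.comp continuous_snd) continuous_const

end Representatives

/-! ### The subspace `M` of `X(M, S¹)` -/

section Embedding

theorem isInducing_of_leftInverse_of_continuousAt {X Y : Type*} [TopologicalSpace X]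
    [TopologicalSpace Y] {f : X → Y} {g : Y → X} (hf : Continuous f)
    (hgf : Function.LeftInverse g f) (hg : ∀ x, ContinuousAt g (f x)) : IsInducing f := by
  refine isInducing_iff_nhds.2 fun x => le_antisymm hf.continuousAt.tendsto.le_comap ?_
  intro U hU
  refine ⟨g ⁻¹' U, hg x ?_, fun y hy => ?_⟩
  · rwa [hgf x]
  · simpa [hgf y] using hy

theorem GPPSCircle.isInducing_mk_one {M : Type*} [TopologicalSpace M] {τ : M ≃ₜ M}
    {hτ : Function.Involutive τ} : IsInducing fun x : M => mk τ hτ (x, 1) := by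
  -- The real part is positive at `1`, so the half-circle representative recovers `x` from `[x, 1]`.
  let h : Circle → ℝ := fun z => (z : ℂ).re
  have hodd : ∀ z, h (-z) = -h z := fun z => by simp [h]
  have h1 (x : M) : halfRep h (mk τ hτ (x, 1)) = (x, 1) := halfRep_mk hodd (by simp [h])
  refine isInducing_of_leftInverse_of_continuousAt (g := fun y => (halfRep h y).1)
    (continuous_mk.comp (by fun_prop)) (fun x => congrArg Prod.fst (h1 x)) fun x => ?_
  refine continuous_fst.continuousAt.comp (continuousAt_halfRep hodd (by fun_prop) ?_)
  rcases mk_eq_iff.1 (mk_out (mk τ hτ (x, 1))).symm with h' | h' <;> simp [h', h]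

end Embedding

/-! ### Motion planners on `X(M, S¹)` -/

section Saturation

variable {M : Type*} [TopologicalSpace M] {τ : M ≃ₜ M} {hτ : Function.Involutive τ} {k : ℕ}

variable (hτ) in
/-- The subset of `X(M, S¹)^k` that corresponds to an invariant subset of `M^k`. -/
def saturation (U : Set (Fin k → M)) : Set (Fin k → GPPSCircle τ hτ) :=
  {y | (fun j => (Quotient.out (y j)).1) ∈ U}

variable {U : Set (Fin k → M)}

/-- Two choices of representatives differ by an element of `⟨τ⟩^k`, so invariance makes the choice
immaterial. -/
theorem mem_saturation_iff
    (hU : letI : MulAction (Fin k → Subgroup.zpowers τ) (Fin k → M) := Pi.mulAction'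
      IsInvariant (Fin k → Subgroup.zpowers τ) U)
    {y : Fin k → GPPSCircle τ hτ} {p : Fin k → M × Circle}
    (hp : ∀ j, GPPSCircle.mk τ hτ (p j) = y j) :
    y ∈ saturation hτ U ↔ (fun j => (p j).1) ∈ U := by
  let _ : MulAction (Fin k → Subgroup.zpowers τ) (Fin k → M) := Pi.mulAction'
  choose g hg using fun j =>
    GPPSCircle.exists_smul_eq ((hp j).trans (GPPSCircle.mk_out (y j)).symm)
  rw [← hU.smul_mem_iff g]
  have : g • (fun j => (p j).1) = fun j => (Quotient.out (y j)).1 := funext hg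
  rw [this]
  rfl

theorem isOpen_saturation
    (hU : letI : MulAction (Fin k → Subgroup.zpowers τ) (Fin k → M) := Pi.mulAction'
      IsInvariant (Fin k → Subgroup.zpowers τ) U)
    (hO : IsOpen U) : IsOpen (saturation hτ U) := by
  have hq : IsOpenQuotientMap (Pi.map fun _ : Fin k => GPPSCircle.mk τ hτ) :=
    .piMap fun _ => GPPSCircle.isOpenQuotientMap_mk
  rw [← hq.isQuotientMap.isOpen_preimage]
  have : (Pi.map fun _ : Fin k => GPPSCircle.mk τ hτ) ⁻¹' saturation hτ U =
      {p : Fin k → M × Circle | (fun j => (p j).1) ∈ U} := by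
    ext p
    exact mem_saturation_iff hU fun j => rfl
  rw [this]
  exact hO.preimage (by fun_prop)

/-- Over points with chosen halves of the circle in which their circle coordinates lie, a motion
planner on `M` gives one on `X(M, S¹)`. -/
theorem hasSectionOver_saturation
    (hU : letI : MulAction (Fin k → Subgroup.zpowers τ) (Fin k → M) := Pi.mulAction'
      IsInvariant (Fin k → Subgroup.zpowers τ) U)
    (hk : 2 ≤ k) (hs : HasSectionOver (pathEval k M) U)
    {h : Fin k → Circle → ℝ} (hodd : ∀ j z, h j (-z) = -h j z) (hc : ∀ j, Continuous (h j))
    (hslit : ∀ j z, 0 < h j z → (z : ℂ) ∈ Complex.slitPlane) :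
    HasSectionOver (pathEval k (GPPSCircle τ hτ))
      (saturation hτ U ∩ {y | ∀ j, h j (Quotient.out (y j)).2 ≠ 0}) := by
  obtain ⟨s, hs⟩ := hs
  set O := saturation hτ U ∩ {y | ∀ j, h j (Quotient.out (y j)).2 ≠ 0}
  let r : O → Fin k → M × Circle := fun y j => GPPSCircle.halfRep (h j) (y.1 j)
  have hmk (y : O) (j) : GPPSCircle.mk τ hτ (r y j) = y.1 j := GPPSCircle.mk_halfRep _ _
  have hr (j) : Continuous fun y => r y j := by
    refine continuous_iff_continuousAt.2 fun y => ?_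
    exact (GPPSCircle.continuousAt_halfRep (hodd j) (hc j) (y.2.2 j)).comp
      (f := fun y : O => y.1 j)
      ((continuous_apply j).comp continuous_subtype_val).continuousAt
  have ha (j) : Continuous fun y => Complex.arg (r y j).2 := by
    refine continuous_iff_continuousAt.2 fun y => ?_
    have h1 := Complex.continuousAt_arg (hslit j _ (GPPSCircle.pos_of_ne (hodd j) (y.2.2 j)))
    exact h1.comp (f := fun y => ((r y j).2 : ℂ))
      (continuous_subtype_val.comp (continuous_snd.comp (hr j))).continuousAt
  have hm (y : O) : (fun j => (r y j).1) ∈ U := (mem_saturation_iff hU (hmk y)).1 y.2.1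
  -- At the `j`-th node only the `j`-th weight `1 - tent` survives, so the circle component is the
  -- chosen representative there.
  let F : O → unitInterval → GPPSCircle τ hτ := fun y t => GPPSCircle.mk τ hτ
    (s ⟨_, hm y⟩ t, Circle.exp (∑ j, Complex.arg (r y j).2 * (1 - (tent k j t : ℝ))))
  refine HasSectionOver.pathEval_of_continuousOn F ?_ fun y j => ?_
  · refine GPPSCircle.continuous_mk.comp ?_
    have ht := continuous_tent k
    refine Continuous.prodMk ?_ (Circle.exp.continuous.comp ?_)
    · have h1 : Continuous fun y : O => (⟨_, hm y⟩ : U) :=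
        (continuous_pi fun j => continuous_fst.comp (hr j)).subtype_mk _
      have h2 : Continuous fun q : O × unitInterval => s ⟨_, hm q.1⟩ :=
        s.continuous.comp (h1.comp continuous_fst)
      exact h2.eval continuous_snd
    · refine continuous_finsetSum _ fun j _ => ?_
      exact ((ha j).comp continuous_fst).mul
        (continuous_const.sub (continuous_subtype_val.comp ((ht j).comp continuous_snd)))
  · have h1 : s ⟨_, hm y⟩ (node k j) = (r y j).1 := congrFun (hs ⟨_, hm y⟩) j
    have h2 : ∑ i, Complex.arg (r y i).2 * (1 - (tent k i (node k j) : ℝ)) =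
        Complex.arg (r y j).2 := by
      rw [Finset.sum_eq_single j]
      · simp [tent_node_self hk]
      · intro i _ hij
        simp [tent_node_of_ne hk hij.symm]
      · simp
    simp only [F, h1, h2, Circle.exp_arg]
    exact hmk y j

end Saturation

theorem TC_GPPSCircle_le {M : Type*} [TopologicalSpace M] {τ : M ≃ₜ M}
    {hτ : Function.Involutive τ} {k : ℕ} (hk : 2 ≤ k)
    [CompletelyNormalSpace (Fin k → GPPSCircle τ hτ)] {n : ℕ}
    (h : letI : MulAction (Fin k → Subgroup.zpowers τ) (Fin k → M) := Pi.mulAction'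
      HasOpenCover (fun U : Set (Fin k → M) => IsInvariant (Fin k → Subgroup.zpowers τ) U ∧
        HasSectionOver (pathEval k M) U) (n + 1)) :
    TC k (GPPSCircle τ hτ) ≤ (n + k + 1 : ℕ) := by
  classical
  obtain ⟨U, hO, hc, hU⟩ := h
  -- Both the right and the upper half circle avoid the negative real axis, where `Complex.arg`
  -- jumps.
  let h : Prop → Circle → ℝ := fun P z => if P then (z : ℂ).re else (z : ℂ).im
  have hodd (P z) : h P (-z) = -h P z := by
    by_cases hP : P <;> simp [h, hP]
  have hcont (P) : Continuous (h P) := by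
    by_cases hP : P <;> simp only [h, hP, if_true, if_false] <;> fun_prop
  have hslit (P) (z : Circle) (hz : 0 < h P z) : (z : ℂ) ∈ Complex.slitPlane := by
    rw [Complex.mem_slitPlane_iff]
    by_cases hP : P
    · exact Or.inl (by simpa [h, hP] using hz)
    · exact Or.inr (by simpa [h, hP] using hz.ne')
  let V : Fin (n + 1) → Set (Fin k → GPPSCircle τ hτ) := fun i => saturation hτ (U i)
  have hV : ⋃ i, V i = Set.univ := by
    refine Set.eq_univ_of_forall fun y => Set.mem_iUnion.2 ?_
    have : (fun j => (Quotient.out (y j)).1) ∈ ⋃ i, U i := hc.symm ▸ Set.mem_univ _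
    obtain ⟨i, hi⟩ := Set.mem_iUnion.1 this
    exact ⟨i, hi⟩
  have hVO (i) : IsOpen (V i) := isOpen_saturation (hU i).1 (hO i)
  let S : Fin k → (Fin k → GPPSCircle τ hτ) → Prop := fun j y =>
    h False (Quotient.out (y j)).2 = 0
  let ρ : Option (Fin k) → (Fin k → GPPSCircle τ hτ) → ℕ := fun c y =>
    c.elim (coverRank V y) fun j => if S j y then 1 else 0
  let Y := Fin k → GPPSCircle τ hτ
  -- `TC` asks for no invariance, so the trivial group serves.
  have key := hasOpenCover_of_rank (G := (⊥ : Subgroup (Y ≃ₜ Y)))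
    (p := pathEval k (GPPSCircle τ hτ)) (ρ := ρ) (d := fun c => c.elim n fun _ => 1)
    (fun g => g.1.continuous) ?_ ?_ ?_ ?_
  · have hsum : ∑ c : Option (Fin k), (c.elim n fun _ => 1) + 1 = n + k + 1 := by
      simp [Fintype.sum_option]
    rw [hsum] at key
    exact (coverNumber_mono fun _ h => h.2).trans (coverNumber_le key)
  · rintro (_ | j) y
    · exact Nat.le_of_lt_succ (exists_mem_coverRank hV y).1
    · simp only [ρ, Option.elim]
      split_ifs <;> simp
  · rintro (_ | j) i
    · exact isOpen_coverRank_lt hV hVO i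
    · have h1 : IsOpen {y | ¬ S j y} :=
        (GPPSCircle.isOpen_ne (hodd False) (hcont False)).preimage
          (f := fun y : Fin k → GPPSCircle τ hτ => y j) (continuous_apply j)
      rcases i with _ | _ | i
      · simp
      · convert h1 using 3 with y
        simp [ρ]
      · convert isOpen_univ using 1
        refine Set.eq_univ_of_forall fun y => ?_
        simp only [ρ, Option.elim, Set.mem_ofPred_eq]
        split_ifs <;> omega
  · intro c g y
    obtain rfl := Subsingleton.elim g 1
    rw [one_smul]
  · intro y
    obtain ⟨hlt, -⟩ := exists_mem_coverRank hV y
    refine ⟨_, ?_, ?_, hasSectionOver_saturation (hU ⟨coverRank V y, hlt⟩).1 hk (hU _).2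
      (h := fun j => h (S j y)) (fun j => hodd _) (fun j => hcont _) fun j => hslit _⟩
    · refine (hVO _).inter ?_
      simp only [Set.ofPred_forall]
      exact isOpen_iInter_of_finite fun j =>
        (GPPSCircle.isOpen_ne (hodd _) (hcont _)).preimage
          (f := fun y : Fin k → GPPSCircle τ hτ => y j) (continuous_apply j)
    · intro y' hy'
      have h0 : coverRank V y' = coverRank V y := hy' none
      refine ⟨?_, fun j => ?_⟩
      · obtain ⟨hlt', hmem⟩ := exists_mem_coverRank hV y'
        simp only [h0] at hmem
        exact hmem
      · have h1 : S j y' ↔ S j y := by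
          have := hy' (some j)
          simp only [ρ, Option.elim] at this
          split_ifs at this <;> simp_all
        change h (S j y) (Quotient.out (y' j)).2 ≠ 0
        by_cases hS : S j y
        -- A real point of the circle has nonzero real part.
        · have him : ((Quotient.out (y' j)).2 : ℂ).im = 0 := by simpa [S, h] using h1.2 hS
          intro hre
          have hre' : ((Quotient.out (y' j)).2 : ℂ).re = 0 := by simpa [h, hS] using hre
          exact Circle.coe_ne_zero _ (Complex.ext hre' him)
        · rw [show h (S j y) = h False by simp only [hS]]
          exact mt h1.1 hS

/-! ### Finiteness of `⟨τ⟩` and the two inequalities -/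

theorem finite_zpowers_of_involutive {M : Type*} [TopologicalSpace M] {τ : M ≃ₜ M}
    (hτ : Function.Involutive τ) : Finite (Subgroup.zpowers τ) := by
  have : IsOfFinOrder τ := isOfFinOrder_iff_pow_eq_one.2 ⟨2, two_pos, by
    ext x
    simpa [sq] using hτ x⟩
  exact finite_zpowers.2 this

end SeqTC

theorem mainTheorem10 {M : Type*} [TopologicalSpace M] [PathConnectedSpace M]
    (τ : M ≃ₜ M) (hτ : Function.Involutive τ) (k : ℕ) (hk : 2 ≤ k)
    (hT2 : T2Space (SeqTC.GPPSCircle τ hτ))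
    (hCN : CompletelyNormalSpace (Fin k → SeqTC.GPPSCircle τ hτ)) :
    SeqTC.TC k (SeqTC.GPPSCircle τ hτ)
        ≤ (k : ℕ∞) + SeqTC.strongTCWrt k (Subgroup.zpowers τ) M ∧
      (k : ℕ∞) + SeqTC.strongTCWrt k (Subgroup.zpowers τ) M
        ≤ (k : ℕ∞) * SeqTC.catWrt (Subgroup.zpowers τ) M + 1 := by
  obtain ⟨x⟩ : Nonempty M := inferInstance
  constructor
  · by_cases hT : SeqTC.strongTCWrt k (Subgroup.zpowers τ) M = ⊤
    · simp [hT]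
    · obtain ⟨n, hn, hcov⟩ := SeqTC.exists_coverNumber_eq hT
      have hn' : SeqTC.strongTCWrt k (Subgroup.zpowers τ) M = n := hn
      rw [hn']
      -- An empty cover is impossible since `M` is nonempty.
      obtain _ | n := n
      · obtain ⟨U, -, hU, -⟩ := hcov
        obtain ⟨i, -⟩ := Set.mem_iUnion.1 (hU.symm ▸ Set.mem_univ (fun _ : Fin k => x))
        exact i.elim0
      · refine (SeqTC.TC_GPPSCircle_le hk hcov).trans ?_
        norm_cast
        omega
  · by_cases hT : SeqTC.catWrt (Subgroup.zpowers τ) M = ⊤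
    · rw [hT, ENat.mul_top (by simp; omega)]
      simp
    · obtain ⟨n, hn, hcov⟩ := SeqTC.exists_coverNumber_eq hT
      have hn' : SeqTC.catWrt (Subgroup.zpowers τ) M = n := hn
      rw [hn']
      obtain _ | n := n
      · obtain ⟨U, -, hU, -⟩ := hcov
        obtain ⟨i, -⟩ := Set.mem_iUnion.1 (hU.symm ▸ Set.mem_univ x)
        exact i.elim0
      · have := SeqTC.finite_zpowers_of_involutive hτ
        have : CompletelyNormalSpace (Fin k → M) :=
          (IsInducing.piMap fun _ : Fin k =>
            SeqTC.GPPSCircle.isInducing_mk_one (hτ := hτ)).completelyNormalSpace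
        refine (add_le_add_right (SeqTC.strongTCWrt_le hk (fun g => g.1.continuous) hcov) _).trans ?_
        norm_cast
        linarith
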